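/- **Conventions.** Let $e$ be the one-object category. A *prederivator* $\mathbb D$ is a strict $2$-functor from small categories to (not necessarily small) categories, contravariant on functors and on natural transformations: it assigns to each small category $A$ a category $\mathbb D(A)$, to each functor $u:A\to B$ a functor $u^*:\mathbb D(B)\to\mathbb D(A)$, and to each $\alpha:u\to v$ a transformation $\alpha^*:v^*\to u^*$. A right (resp. left) adjoint of $u^*$, if it exists, is denoted $u_*$ (resp. $u_!$). For a functor $u:A\to B$ and an object $b$ of $B$, $A/b$ is the category of pairs $(a,\,u(a)\to b)$ and $b\backslash A$ that of pairs $(a,\,b\to u(a))$. A *square* consists of functors $u:A\to B$, $u':A'\to B'$, $v:A'\to A$, $w:B'\to B$ between small categories and a natural transformation $\alpha:uv\to wu'$. It satisfies the *cohomological base-change property* for $\mathbb D$ if $u_*$ and $u'_*$ exist and the morphism $w^*u_*\to u'_*v^*$, the mate of $\alpha^*:u'^*w^*\to v^*u^*$, is an isomorphism. Dually, it satisfies the *homological base-change property* if $v_!$ and $w_!$ exist and the mate $v_!u'^*\to u^*w_!$ of $\alpha^*$ is an isomorphism. The prederivator $\mathbb D$ is * *conservative* if a morphism $\varphi$ of $\mathbb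 D(A)$ is an isomorphism as soon as $a^*(\varphi)$ is one for every object $a:e\to A$ of $A$; * *complete* if $u_*$ exists for every functor $u:A\to B$ between small categories and, for every $u$ and every object $b$ of $B$, the comma square $A'=A/b$, $B'=e$, $w=b$ satisfies the cohomological base-change property; * *cocomplete* if $u_!$ exists for every functor $u:A\to B$ between small categories and, for every $u$ and every object $b$ of $B$, the comma square with top $b\backslash A\to e$, left side the projection $b\backslash A\to A$, right side $b:e\to B$ and bottom $u:A\to B$ satisfies the homological base-change property; * a *derivator* if it is conservative, complete and cocomplete and, for every finite family $(A_i)$ of small categories, the canonical functor $\mathbb D(\coprod_iA_i)\to\prod_i\mathbb D(A_i)$ is an equivalence. A functor $u:A\to B$ between small categories, with $q:B\to e$ and $p=qu$, is a *$\mathbb D$-equivalence* if for all objects $X,Y$ of $\mathbb D(e)$ the map $\mathrm{Hom}_{\mathbb D(B)}(q^*X,q^*Y)\to\mathrm{Hom}_{\mathbb D(A)}(p^*X,p^*Y)$ induced by $u^*$ is bijective. Given also $w:B\to C$ and $v=wu$, $u$ is a *$\mathbb D$-equivalence colocally over $C$* if for every object $c$ of $C$ the induced functor $c\backslash A\to c\backslash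 B$ is a $\mathbb D$-equivalence. A prederivator $\mathbb D$ for which all $u_*$ exist satisfies the *cohomological criterion for colocal equivalences* if, for every such triangle in which $u$ is a $\mathbb D$-equivalence colocally over $C$, the canonical morphism $q_*w^*\to p_*v^*$ is an isomorphism. A square is *weakly $\mathbb D$-exact* if for every object $b'$ of $B'$ the functor $A'/b'\to A/w(b')$, $(a',\,g':u'(a')\to b')\mapsto(v(a'),\,w(g')\alpha_{a'})$, is a $\mathbb D$-equivalence colocally over $A$, where $A/w(b')\to A$ is the projection. **Theorem.** Let $\mathbb D$ be a conservative and complete prederivator satisfying the cohomological criterion for colocal equivalences. Then a square of small categories satisfies the cohomological base-change property for $\mathbb D$ if and only if it is weakly $\mathbb D$-exact. Moreover, every derivator is a conservative and complete prederivator satisfying this criterion. -/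

import Mathlib

open CategoryTheory

universe w v u

/-- A prederivator: a strict 2-functor from small categories to (not necessarily small) categories,
contravariant on functors and on natural transformations. -/
structure Prederivator where
  /-- The category `D(A)`. -/
  obj (A : Type w) [SmallCategory.{w} A] : Type u
  /-- The category structure on `D(A)`. -/
  cat (A : Type w) [SmallCategory.{w} A] : Category.{v} (obj A)
  /-- The inverse image functor `f^* : D(B) ⥤ D(A)` of `f : A ⥤ B`. -/
  map {A B : Type w} [SmallCategory.{w} A] [SmallCategory.{w} B] (f : A ⥤ B) : obj B ⥤ obj A
  /-- The transformation `α^* : g^* ⟶ f^*` attached to `α : f ⟶ g`. -/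
  map₂ {A B : Type w} [SmallCategory.{w} A] [SmallCategory.{w} B] {f g : A ⥤ B} (α : f ⟶ g) :
    map g ⟶ map f
  map_id (A : Type w) [SmallCategory.{w} A] : map (𝟭 A) = 𝟭 (obj A)
  map_comp {A B C : Type w} [SmallCategory.{w} A] [SmallCategory.{w} B] [SmallCategory.{w} C]
    (f : A ⥤ B) (g : B ⥤ C) : map (f ⋙ g) = map g ⋙ map f
  map₂_id {A B : Type w} [SmallCategory.{w} A] [SmallCategory.{w} B] (f : A ⥤ B) :
    map₂ (𝟙 f) = 𝟙 (map f)
  map₂_comp {A B : Type w} [SmallCategory.{w} A] [SmallCategory.{w} B] {f g h : A ⥤ B}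
    (α : f ⟶ g) (β : g ⟶ h) : map₂ (α ≫ β) = map₂ β ≫ map₂ α
  map₂_whiskerLeft {A B C : Type w} [SmallCategory.{w} A] [SmallCategory.{w} B]
    [SmallCategory.{w} C] (f : A ⥤ B) {g h : B ⥤ C} (α : g ⟶ h) :
    map₂ (Functor.whiskerLeft f α) =
      eqToHom (map_comp f h) ≫ Functor.whiskerRight (map₂ α) (map f) ≫
        eqToHom (map_comp f g).symm
  map₂_whiskerRight {A B C : Type w} [SmallCategory.{w} A] [SmallCategory.{w} B]
    [SmallCategory.{w} C] {f g : A ⥤ B} (α : f ⟶ g) (h : B ⥤ C) :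
    map₂ (Functor.whiskerRight α h) =
      eqToHom (map_comp g h) ≫ Functor.whiskerLeft (map h) (map₂ α) ≫
        eqToHom (map_comp f h).symm

attribute [instance] Prederivator.cat

namespace CategoryTheory.TwoSquare

universe v₁ v₂ v₃ v₄ u₁ u₂ u₃ u₄

variable {C₁ : Type u₁} {C₂ : Type u₂} {C₃ : Type u₃} {C₄ : Type u₄}
  [Category.{v₁} C₁] [Category.{v₂} C₂] [Category.{v₃} C₃] [Category.{v₄} C₄]
  {T : C₁ ⥤ C₂} {L : C₁ ⥤ C₃} {R : C₂ ⥤ C₄} {B : C₃ ⥤ C₄}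

/-- A square `σ : T ⋙ R ⟶ L ⋙ B` is left Beck-Chevalley if the vertical functors `L`, `R` have
right adjoints `L'`, `R'` and the base change morphism `L' ⋙ T ⟶ B ⋙ R'`, the mate of `σ`,
is an isomorphism. -/
def IsLeftBeckChevalley (σ : TwoSquare T L R B) : Prop :=
  ∃ (L' : C₃ ⥤ C₁) (R' : C₄ ⥤ C₂) (adjL : L ⊣ L') (adjR : R ⊣ R'),
    IsIso (mateEquiv adjL adjR σ).natTrans

/-- A square `σ : T ⋙ R ⟶ L ⋙ B` is right Beck-Chevalley if the horizontal functors `T`, `B` have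
left adjoints `T'`, `B'` and the base change morphism `R ⋙ B' ⟶ T' ⋙ L`, the mate of `σ`,
is an isomorphism. -/
def IsRightBeckChevalley (σ : TwoSquare T L R B) : Prop :=
  ∃ (T' : C₂ ⥤ C₁) (B' : C₄ ⥤ C₃) (adjT : T' ⊣ T) (adjB : B' ⊣ B),
    IsIso ((mateEquiv adjT adjB).symm σ).natTrans

end CategoryTheory.TwoSquare

namespace Prederivator

/-- The one-object category `e`. -/
abbrev Pt : Type w := Discrete PUnit.{w + 1}

/-- The functor from `A` to the one-object category. -/
abbrev toPt (A : Type w) [SmallCategory.{w} A] : A ⥤ Pt.{w} := Functor.star.{w} A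

/-- The functor from the one-object category to `A` given by an object `a`. -/
abbrev point {A : Type w} [SmallCategory.{w} A] (a : A) : Pt.{w} ⥤ A := Functor.fromPUnit.{w} a

variable (D : Prederivator.{w, v, u})

variable {A A' B B' C : Type w} [SmallCategory.{w} A] [SmallCategory.{w} A']
  [SmallCategory.{w} B] [SmallCategory.{w} B'] [SmallCategory.{w} C]

/-- The image under `D` of a square `α : v ⋙ u ⟶ u' ⋙ w` of small categories, a square
`α^* : w^* ⋙ u'^* ⟶ u^* ⋙ v^*`. -/
def mapSquare {v : A' ⥤ A} {u' : A' ⥤ B'} {u : A ⥤ B} {w : B' ⥤ B} (σ : TwoSquare v u' u w) :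
    TwoSquare (D.map w) (D.map u) (D.map u') (D.map v) :=
  TwoSquare.mk _ _ _ _
    (eqToHom (D.map_comp u' w).symm ≫ D.map₂ σ.natTrans ≫ eqToHom (D.map_comp v u))

/-- The comma square with top `A/b ⥤ A`, left `A/b ⥤ e`, right `f : A ⥤ B`, bottom `b`. -/
def commaSquareOver (f : A ⥤ B) (b : B) :
    TwoSquare (CostructuredArrow.proj f b) (toPt (CostructuredArrow f b)) f (point b) :=
  TwoSquare.mk _ _ _ _
    { app := fun X => X.hom
      naturality := fun _ _ φ => (CostructuredArrow.w φ).trans (Category.comp_id _).symm }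

/-- The comma square with top `b\A ⥤ e`, left `b\A ⥤ A`, right `b`, bottom `f : A ⥤ B`. -/
def commaSquareUnder (f : A ⥤ B) (b : B) :
    TwoSquare (toPt (StructuredArrow b f)) (StructuredArrow.proj b f) (point b) f :=
  TwoSquare.mk _ _ _ _
    { app := fun X => X.hom
      naturality := fun _ _ φ => (Category.id_comp _).trans (StructuredArrow.w φ).symm }

/-- A square satisfies the cohomological base change property for `D` if `u` and `u'` have
cohomological direct images and the base change morphism `u_* ⋙ w^* ⟶ v^* ⋙ u'_*` is an
isomorphism. -/
def CohomologicalBaseChange {v : A' ⥤ A} {u' : A' ⥤ B'} {u : A ⥤ B} {w : B' ⥤ B}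
    (σ : TwoSquare v u' u w) : Prop :=
  (D.mapSquare σ).IsLeftBeckChevalley

/-- The axiom Der 1 (normalization). -/
def IsNormalized : Prop :=
  ∀ (I : Type w) [Finite I] (A : I → Type w) [∀ i, SmallCategory.{w} (A i)],
    (Functor.pi' fun i => D.map (Sigma.incl (C := A) i)).IsEquivalence

/-- The axiom Der 2 (conservativity). -/
def IsConservative : Prop :=
  ∀ (A : Type w) [SmallCategory.{w} A] {X Y : D.obj A} (φ : X ⟶ Y),
    (∀ a : A, IsIso ((D.map (point a)).map φ)) → IsIso φ

/-- The axiom Der 3 (left): each `f^*` has a right adjoint `f_*`. -/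
class HasCohomologicalDirectImages : Prop where
  isLeftAdjoint {A B : Type w} [SmallCategory.{w} A] [SmallCategory.{w} B] (f : A ⥤ B) :
    (D.map f).IsLeftAdjoint

attribute [instance] HasCohomologicalDirectImages.isLeftAdjoint

/-- The axiom Der 3 (right): each `f^*` has a left adjoint `f_!`. -/
class HasHomologicalDirectImages : Prop where
  isRightAdjoint {A B : Type w} [SmallCategory.{w} A] [SmallCategory.{w} B] (f : A ⥤ B) :
    (D.map f).IsRightAdjoint

/-- Complete prederivators: the axioms Der 3 and Der 4 (left). -/
class IsComplete : Prop extends D.HasCohomologicalDirectImages where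
  cohomologicalBaseChange {A B : Type w} [SmallCategory.{w} A] [SmallCategory.{w} B]
    (f : A ⥤ B) (b : B) : (D.mapSquare (commaSquareOver f b)).IsLeftBeckChevalley

/-- Cocomplete prederivators: the axioms Der 3 and Der 4 (right). -/
class IsCocomplete : Prop extends D.HasHomologicalDirectImages where
  homologicalBaseChange {A B : Type w} [SmallCategory.{w} A] [SmallCategory.{w} B]
    (f : A ⥤ B) (b : B) : (D.mapSquare (commaSquareUnder f b)).IsRightBeckChevalley

/-- Derivators. -/
structure IsDerivator : Prop where
  isNormalized : D.IsNormalized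
  isConservative : D.IsConservative
  isComplete : D.IsComplete
  isCocomplete : D.IsCocomplete

/-- `f : A ⥤ B` is a `D`-equivalence if `f^*` is fully faithful on the objects `q^* X` of `D(B)`,
where `X` is an object of `D(e)` and `q : B ⥤ e`. -/
def IsDEquivalence (f : A ⥤ B) : Prop :=
  ∀ X Y : D.obj Pt.{w}, Function.Bijective
    fun φ : (D.map (toPt B)).obj X ⟶ (D.map (toPt B)).obj Y => (D.map f).map φ

/-- For the commutative triangle `f : A ⥤ B`, `g : B ⥤ C`, `f ⋙ g : A ⥤ C`: the functor `f` is a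
`D`-equivalence colocally over `C` if `c\A ⥤ c\B` is a `D`-equivalence for each object `c`. -/
def IsColocalDEquivalence (f : A ⥤ B) (g : B ⥤ C) : Prop :=
  ∀ c : C, D.IsDEquivalence (StructuredArrow.pre c f g)

/-- A square is weakly `D`-exact if for each object `b'` of `B'` the functor `A'/b' ⥤ A/w(b')`
sending `(a', g')` to `(v a', w(g') ∘ α_{a'})` is a `D`-equivalence colocally over `A`. -/
def IsWeaklyExact {v : A' ⥤ A} {u' : A' ⥤ B'} {u : A ⥤ B} {w : B' ⥤ B}
    (σ : TwoSquare v u' u w) : Prop :=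
  ∀ b' : B', D.IsColocalDEquivalence (σ.costructuredArrowRightwards b')
    (CostructuredArrow.proj u (w.obj b'))

/-- The cohomological direct image `f_*`. -/
noncomputable def directImage [D.HasCohomologicalDirectImages] (f : A ⥤ B) :
    D.obj A ⥤ D.obj B :=
  (D.map f).rightAdjoint

/-- The adjunction `f^* ⊣ f_*`. -/
noncomputable def directImageAdjunction [D.HasCohomologicalDirectImages] (f : A ⥤ B) :
    D.map f ⊣ D.directImage f :=
  Adjunction.ofIsLeftAdjoint (D.map f)

/-- With `p : A ⥤ e` and `q : B ⥤ e`, the strict equality `p^* = f^* ∘ q^*`. -/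
theorem map_toPt (f : A ⥤ B) : D.map (toPt A) = D.map (toPt B) ⋙ D.map f :=
  (congrArg D.map (Functor.punit_ext' (toPt A) (f ⋙ toPt B))).trans (D.map_comp f (toPt B))

/-- The canonical morphism `q_* w^* ⟶ p_* v^*` for the triangle `f : A ⥤ B`, `w = g : B ⥤ C`,
`v = f ⋙ g`, with `p : A ⥤ e` and `q : B ⥤ e`. At `Y`, it is the transpose under `p^* ⊣ p_*` of
`p^* q_* g^* Y = f^* q^* q_* g^* Y ⟶ f^* g^* Y = (f ⋙ g)^* Y`, given by the counit of
`q^* ⊣ q_*`. -/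
noncomputable def directImageComparison [D.HasCohomologicalDirectImages]
    (f : A ⥤ B) (g : B ⥤ C) :
    D.map g ⋙ D.directImage (toPt B) ⟶ D.map (f ⋙ g) ⋙ D.directImage (toPt A) where
  app Y := (D.directImageAdjunction (toPt A)).homEquiv _ _
    ((eqToHom (D.map_toPt f)).app ((D.directImage (toPt B)).obj ((D.map g).obj Y)) ≫
      (D.map f).map ((D.directImageAdjunction (toPt B)).counit.app ((D.map g).obj Y)) ≫
      (eqToHom (D.map_comp f g).symm).app Y)
  naturality Y Z φ := by
    rw [← Adjunction.homEquiv_naturality_left]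
    refine Eq.trans ?_ ((D.directImageAdjunction (toPt A)).homEquiv_naturality_right _
      ((D.map (f ⋙ g)).map φ))
    congr 1
    have h₁ := (eqToHom (D.map_toPt f)).naturality
      ((D.directImage (toPt B)).map ((D.map g).map φ))
    have h₂ := (eqToHom (D.map_comp f g).symm).naturality φ
    have h₃ := congrArg (D.map f).map
      ((D.directImageAdjunction (toPt B)).counit.naturality ((D.map g).map φ))
    simp only [Functor.comp_map, Functor.map_comp, Functor.id_map] at h₁ h₂ h₃ ⊢
    rw [reassoc_of% h₁, reassoc_of% h₃, Category.assoc, Category.assoc, h₂]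

/-- The cohomological criterion for colocal equivalences. -/
def ColocalCriterion [D.HasCohomologicalDirectImages] : Prop :=
  ∀ {A B C : Type w} [SmallCategory.{w} A] [SmallCategory.{w} B] [SmallCategory.{w} C]
    (f : A ⥤ B) (g : B ⥤ C), D.IsColocalDEquivalence f g → IsIso (D.directImageComparison f g)

end Prederivator

/-! ### Bijectivity up to transport along equalities of objects -/

namespace CategoryTheory

/-! Everything is compared with one condition on a triangle `f : A ⥤ B`, `g : B ⥤ C`, namely
`IsHomBijective f g`: `f^*` is bijective from morphisms `q^* Z ⟶ g^* Y` to their images under `f^*`.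

By Yoneda and the adjunctions `q^* ⊣ q_*`, `p^* ⊣ p_*`, this says that `q_* g^* ⟶ p_* (f ⋙ g)^*` is
an isomorphism (`isIso_directImageComparison_iff`). It also governs base change
(`cohomologicalBaseChange_iff`): by conservativity the base change morphism may be tested at each
`b'`; pasting with the comma square of `u'` at `b'`, where base change is known, gives the comma
square of `u` at `w(b')` restricted along `A'/b' ⥤ A/w(b')`. So base change holds iff these functors
over `A` are Hom-bijective.

It remains to compare Hom-bijectivity with colocal equivalence. The criterion gives one direction.
For the other (`IsHomBijective.isColocalDEquivalence`), take `Y = c_* X`: base change for the square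
of `c\B` turns morphisms `q^* Z ⟶ g^* c_* X` into morphisms between constant objects on `c\B`.

For a derivator the criterion is proved on the homological side
(`isHomBijective_of_isColocalDEquivalence`): a colocal equivalence makes `(f ⋙ g)_! f^* q^* Z ⟶ g_!
q^* Z` an isomorphism, because its fibre at `c` is computed on `c\A` and `c\B`. -/

theorem bijective_eqToHom_conj_iff {E : Type*} [Category* E] {α : Type*} {X X' Y Y' : E}
    (hX : X = X') (hY : Y' = Y) (F : α → (X' ⟶ Y')) :
    Function.Bijective (fun a => eqToHom hX ≫ F a ≫ eqToHom hY) ↔ Function.Bijective F := by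
  subst hX hY
  simp

theorem bijective_comp_eqToHom_iff {E : Type*} [Category* E] {α : Type*} {X Y Y' : E}
    (hY : Y' = Y) (F : α → (X ⟶ Y')) :
    Function.Bijective (fun a => F a ≫ eqToHom hY) ↔ Function.Bijective F := by
  subst hY
  simp

theorem bijective_eqToHom_comp_iff {E : Type*} [Category* E] {α : Type*} {X X' Y : E}
    (hX : X = X') (F : α → (X' ⟶ Y)) :
    Function.Bijective (fun a => eqToHom hX ≫ F a) ↔ Function.Bijective F := by
  subst hX
  simp

end CategoryTheory

/-! ### Beck-Chevalley conditions as bijections of Hom sets -/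

namespace CategoryTheory.TwoSquare

universe v₁ v₂ v₃ v₄ v₅ v₆ u₁ u₂ u₃ u₄ u₅ u₆

variable {C₁ : Type u₁} {C₂ : Type u₂} {C₃ : Type u₃} {C₄ : Type u₄}
  [Category.{v₁} C₁] [Category.{v₂} C₂] [Category.{v₃} C₃] [Category.{v₄} C₄]
  {T : C₁ ⥤ C₂} {L : C₁ ⥤ C₃} {R : C₂ ⥤ C₄} {B : C₃ ⥤ C₄}

/-- The map sending `φ : Z ⟶ T (L' Y)` to the composite `R Z ⟶ R (T (L' Y)) ⟶ B (L (L' Y)) ⟶ B Y`,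
where `L'` is right adjoint to `L`. -/
def leftTranspose (σ : TwoSquare T L R B) {L' : C₃ ⥤ C₁} (adjL : L ⊣ L') (Y : C₃) (Z : C₂)
    (φ : Z ⟶ T.obj (L'.obj Y)) : R.obj Z ⟶ B.obj Y :=
  R.map φ ≫ σ.natTrans.app (L'.obj Y) ≫ B.map (adjL.counit.app Y)

/-- The map sending `ψ : L (T' W) ⟶ X` to the composite
`R W ⟶ R (T (T' W)) ⟶ B (L (T' W)) ⟶ B X`, where `T'` is left adjoint to `T`. -/
def rightTranspose (σ : TwoSquare T L R B) {T' : C₂ ⥤ C₁} (adjT : T' ⊣ T) (W : C₂) (X : C₃)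
    (ψ : L.obj (T'.obj W) ⟶ X) : R.obj W ⟶ B.obj X :=
  R.map (adjT.unit.app W) ≫ σ.natTrans.app (T'.obj W) ≫ B.map ψ

/-- By Yoneda: composing with the mate and then transposing under `R ⊣ R'` is exactly
`leftTranspose`. The resulting condition no longer mentions `R'`. -/
theorem isIso_mateEquiv_app_iff (σ : TwoSquare T L R B) {L' : C₃ ⥤ C₁} {R' : C₄ ⥤ C₂}
    (adjL : L ⊣ L') (adjR : R ⊣ R') (Y : C₃) :
    IsIso ((mateEquiv adjL adjR σ).natTrans.app Y) ↔
      ∀ Z, Function.Bijective (σ.leftTranspose adjL Y Z) := by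
  rw [isIso_iff_yoneda_map_bijective]
  refine forall_congr' fun Z => ?_
  rw [← (adjR.homEquiv Z (B.obj Y)).symm.bijective.of_comp_iff']
  refine iff_of_eq (congrArg _ (funext fun φ => ?_))
  have h := mateEquiv_counit adjL adjR σ Y
  simp only [Function.comp_apply, Adjunction.homEquiv_counit, Functor.map_comp, Category.assoc,
    leftTranspose]
  exact congrArg (R.map φ ≫ ·) h

theorem isIso_mateEquiv_symm_app_iff (σ : TwoSquare T L R B) {T' : C₂ ⥤ C₁} {B' : C₄ ⥤ C₃}
    (adjT : T' ⊣ T) (adjB : B' ⊣ B) (W : C₂) :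
    IsIso (((mateEquiv adjT adjB).symm σ).natTrans.app W) ↔
      ∀ X, Function.Bijective (σ.rightTranspose adjT W X) := by
  rw [isIso_iff_coyoneda_map_bijective]
  refine forall_congr' fun X => ?_
  rw [← (adjB.homEquiv (R.obj W) X).bijective.of_comp_iff']
  refine iff_of_eq (congrArg _ (funext fun φ => ?_))
  have h := unit_mateEquiv_symm adjT adjB σ W
  simp only [Function.comp_apply, Adjunction.homEquiv_unit, Functor.map_comp, rightTranspose]
  exact ((reassoc_of% h) _).symm

/-- The Beck-Chevalley property only asserts that some adjoints work; uniqueness of adjoints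
transfers the bijection to any chosen one. -/
theorem leftTranspose_bijective_of_adjunction (σ : TwoSquare T L R B) {L' L'' : C₃ ⥤ C₁}
    (adj' : L ⊣ L') (adj'' : L ⊣ L'') (Y : C₃) (Z : C₂)
    (h : Function.Bijective (σ.leftTranspose adj' Y Z)) :
    Function.Bijective (σ.leftTranspose adj'' Y Z) := by
  convert h.comp ((Iso.refl Z).homCongr
    (T.mapIso ((adj''.rightAdjointUniq adj').app Y))).bijective using 1
  funext φ
  have h₁ := σ.natTrans.naturality ((adj''.rightAdjointUniq adj').hom.app Y)
  have h₂ := congrArg B.map (Adjunction.rightAdjointUniq_hom_app_counit adj'' adj' Y)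
  simp only [Functor.comp_map, Functor.map_comp] at h₁ h₂
  simp [leftTranspose, Iso.homCongr, reassoc_of% h₁, h₂]

theorem isLeftBeckChevalley_iff (σ : TwoSquare T L R B) {L' : C₃ ⥤ C₁} (adjL : L ⊣ L')
    [R.IsLeftAdjoint] :
    σ.IsLeftBeckChevalley ↔ ∀ Y Z, Function.Bijective (σ.leftTranspose adjL Y Z) := by
  constructor
  · rintro ⟨L'', R', adj, adjR, _⟩ Y Z
    exact σ.leftTranspose_bijective_of_adjunction adj adjL Y Z
      ((σ.isIso_mateEquiv_app_iff adj adjR Y).1 inferInstance Z)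
  · intro h
    refine ⟨L', _, adjL, Adjunction.ofIsLeftAdjoint R, ?_⟩
    rw [NatTrans.isIso_iff_isIso_app]
    exact fun Y => (σ.isIso_mateEquiv_app_iff _ _ Y).2 (h Y)

theorem rightTranspose_bijective_of_adjunction (σ : TwoSquare T L R B) {T' T'' : C₂ ⥤ C₁}
    (adj' : T' ⊣ T) (adj'' : T'' ⊣ T) (W : C₂) (X : C₃)
    (h : Function.Bijective (σ.rightTranspose adj' W X)) :
    Function.Bijective (σ.rightTranspose adj'' W X) := by
  convert h.comp ((L.mapIso ((adj''.leftAdjointUniq adj').app W)).homCongr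
    (Iso.refl X)).bijective using 1
  funext ψ
  have h₁ := σ.natTrans.naturality ((adj''.leftAdjointUniq adj').inv.app W)
  have h₂ := congrArg R.map (Adjunction.unit_leftAdjointUniq_hom_app adj' adj'' W)
  simp only [Functor.comp_map, Functor.map_comp] at h₁ h₂
  simp only [rightTranspose, ← h₂, Category.assoc, Function.comp_apply, Iso.homCongr_apply,
    Iso.refl_hom, Category.comp_id, Functor.map_comp, Functor.mapIso_inv, Iso.app_inv]
  rw [← reassoc_of% h₁]
  rfl

theorem IsRightBeckChevalley.bijective {σ : TwoSquare T L R B} (h : σ.IsRightBeckChevalley)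
    {T' : C₂ ⥤ C₁} (adjT : T' ⊣ T) (W : C₂) (X : C₃) :
    Function.Bijective (σ.rightTranspose adjT W X) := by
  obtain ⟨T'', B', adj, adjB, _⟩ := h
  exact σ.rightTranspose_bijective_of_adjunction adj adjT W X
    ((σ.isIso_mateEquiv_symm_app_iff adj adjB W).1 inferInstance X)

variable {C₅ : Type u₅} {C₆ : Type u₆} [Category.{v₅} C₅] [Category.{v₆} C₆]
  {T' : C₂ ⥤ C₅} {R' : C₅ ⥤ C₆} {B' : C₄ ⥤ C₆}

/-- Transposing through the pasted square amounts to applying `T'` of the mate of `σ` and then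
transposing through `τ`. The second map is bijective, so only the first matters. -/
theorem isIso_map_mateEquiv_app_iff (σ : TwoSquare T L R B) (τ : TwoSquare T' R R' B')
    {L' : C₃ ⥤ C₁} {S : C₄ ⥤ C₂} (adjL : L ⊣ L') (adjR : R ⊣ S)
    (hτ : ∀ Y Z, Function.Bijective (τ.leftTranspose adjR Y Z)) (Y : C₃) :
    IsIso (T'.map ((mateEquiv adjL adjR σ).natTrans.app Y)) ↔
      ∀ Z, Function.Bijective ((hComp σ τ).leftTranspose adjL Y Z) := by
  rw [isIso_iff_yoneda_map_bijective]
  refine forall_congr' fun Z => ?_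
  rw [← (hτ (B.obj Y) Z).of_comp_iff']
  refine iff_of_eq (congrArg _ (funext fun φ => ?_))
  have h₁ := congrArg B'.map (mateEquiv_counit adjL adjR σ Y)
  have h₂ := τ.natTrans.naturality ((mateEquiv adjL adjR σ).natTrans.app Y)
  simp only [Functor.comp_map, Functor.map_comp] at h₁ h₂
  simp only [Function.comp_apply, leftTranspose, Functor.map_comp, Category.assoc, natTrans,
    hComp_app, Functor.comp_map]
  rw [reassoc_of% h₂]
  erw [h₁]

end CategoryTheory.TwoSquare

/-! ### Strict 2-functoriality on components -/

namespace Prederivator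


variable (D : Prederivator.{w, v, u})

variable {A A' B B' C : Type w} [SmallCategory.{w} A] [SmallCategory.{w} A']
  [SmallCategory.{w} B] [SmallCategory.{w} B'] [SmallCategory.{w} C]

theorem mapSquare_app {v : A' ⥤ A} {u' : A' ⥤ B'} {u : A ⥤ B} {w : B' ⥤ B}
    (σ : TwoSquare v u' u w) (X : D.obj B) :
    (D.mapSquare σ).natTrans.app X =
      eqToHom (congrArg (fun F => F.obj X) (D.map_comp u' w).symm) ≫
        (D.map₂ σ.natTrans).app X ≫
          eqToHom (congrArg (fun F => F.obj X) (D.map_comp v u)) := by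
  simp [mapSquare, TwoSquare.natTrans, TwoSquare.mk, eqToHom_app]

theorem obj_map_eq {f : A ⥤ B} {g : B ⥤ C} {h : A ⥤ C} (e : f ⋙ g = h) (X : D.obj C) :
    (D.map f).obj ((D.map g).obj X) = (D.map h).obj X := by
  subst e; rw [D.map_comp]; rfl

theorem map_map_map {f : A ⥤ B} {g : B ⥤ C} {h : A ⥤ C} (e : f ⋙ g = h) {X Y : D.obj C}
    (φ : X ⟶ Y) :
    (D.map f).map ((D.map g).map φ) =
      eqToHom (D.obj_map_eq e X) ≫ (D.map h).map φ ≫ eqToHom (D.obj_map_eq e Y).symm := by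
  subst e
  exact (Functor.congr_hom (D.map_comp f g).symm φ)

theorem map₂_app_congr {f f' g g' : A ⥤ B} (hf : f = f') (hg : g = g') (α : f ⟶ g) (α' : f' ⟶ g')
    (h : ∀ a, α.app a = eqToHom (congrArg (fun F => F.obj a) hf) ≫ α'.app a ≫
      eqToHom (congrArg (fun F => F.obj a) hg.symm)) (X : D.obj B) :
    (D.map₂ α).app X = eqToHom (congrArg (fun F => (D.map F).obj X) hg) ≫ (D.map₂ α').app X ≫
      eqToHom (congrArg (fun F => (D.map F).obj X) hf.symm) := by
  subst hf hg
  have : α = α' := by ext a; simpa using h a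
  subst this
  simp

theorem map_map₂_app (f : A ⥤ B) {g h : B ⥤ C} (α : g ⟶ h) (X : D.obj C) :
    (D.map f).map ((D.map₂ α).app X) =
      eqToHom (D.obj_map_eq rfl X) ≫ (D.map₂ (Functor.whiskerLeft f α)).app X ≫
        eqToHom (D.obj_map_eq rfl X).symm := by
  rw [D.map₂_whiskerLeft]
  simp [eqToHom_app]

theorem map₂_app_obj {f g : A ⥤ B} (α : f ⟶ g) (h : B ⥤ C) (X : D.obj C) :
    (D.map₂ α).app ((D.map h).obj X) =
      eqToHom (D.obj_map_eq rfl X) ≫ (D.map₂ (Functor.whiskerRight α h)).app X ≫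
        eqToHom (D.obj_map_eq rfl X).symm := by
  rw [D.map₂_whiskerRight]
  simp [eqToHom_app]

theorem map₂_app_comp {f g g' h : A ⥤ B} (α : f ⟶ g) (β : g' ⟶ h) (e : g = g') (X : D.obj B) :
    (D.map₂ β).app X ≫ eqToHom (congrArg (fun F => (D.map F).obj X) e.symm) ≫
      (D.map₂ α).app X = (D.map₂ (α ≫ eqToHom e ≫ β)).app X := by
  subst e
  simp [D.map₂_comp]

/-! ### Hom-bijectivity and the base change criterion -/

/-- The functor `f^*` induces bijections `Hom(q^* Z, g^* Y) ≃ Hom(f^* q^* Z, f^* g^* Y)` for all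
`Z` in `D(e)` and `Y` in `D(C)`, where `q : B ⥤ e`. -/
def IsHomBijective (f : A ⥤ B) (g : B ⥤ C) : Prop :=
  ∀ (Z : D.obj Pt.{w}) (Y : D.obj C), Function.Bijective
    fun φ : (D.map (toPt B)).obj Z ⟶ (D.map g).obj Y => (D.map f).map φ

theorem isIso_directImageComparison_iff [D.HasCohomologicalDirectImages] (f : A ⥤ B) (g : B ⥤ C) :
    IsIso (D.directImageComparison f g) ↔ D.IsHomBijective f g := by
  rw [NatTrans.isIso_iff_isIso_app, IsHomBijective, forall_comm]
  refine forall_congr' fun Y => ?_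
  rw [isIso_iff_yoneda_map_bijective]
  refine forall_congr' fun Z => ?_
  rw [← ((D.directImageAdjunction (toPt A)).homEquiv Z _).symm.bijective.of_comp_iff',
    ← ((D.directImageAdjunction (toPt B)).homEquiv Z _).symm.bijective.of_comp_iff,
    ← bijective_eqToHom_conj_iff (congrArg (fun F => F.obj Z) (D.map_toPt f))
      (congrArg (fun F => F.obj Y) (D.map_comp f g).symm)]
  refine iff_of_eq (congrArg _ (funext fun φ => ?_))
  simp only [Function.comp_apply, Adjunction.homEquiv_naturality_left_symm, directImageComparison,
    Equiv.symm_apply_apply]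
  rw [Adjunction.homEquiv_counit, Functor.map_comp, Category.assoc, eqToHom_app, eqToHom_app,
    Functor.congr_hom (D.map_toPt f) φ]
  simp

theorem point_comp (b : B) (g : B ⥤ C) : point b ⋙ g = point (g.obj b) :=
  CategoryTheory.Functor.ext (fun _ => rfl) fun X Y f => by simp

theorem comp_toPt (f : A ⥤ B) : f ⋙ toPt B = toPt A :=
  Functor.punit_ext' _ _

theorem costructuredArrowRightwards_comp_proj {v : A' ⥤ A} {u' : A' ⥤ B'} {u : A ⥤ B}
    {w : B' ⥤ B} (σ : TwoSquare v u' u w) (b' : B') :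
    σ.costructuredArrowRightwards b' ⋙ CostructuredArrow.proj u (w.obj b') =
      CostructuredArrow.proj u' b' ⋙ v :=
  rfl

theorem costructuredArrowRightwards_obj_eq {v : A' ⥤ A} {u' : A' ⥤ B'} {u : A ⥤ B}
    {w : B' ⥤ B} (σ : TwoSquare v u' u w) (b' : B') (Y : D.obj A) :
    (D.map (σ.costructuredArrowRightwards b')).obj
        ((D.map (CostructuredArrow.proj u (w.obj b'))).obj Y) =
      (D.map (CostructuredArrow.proj u' b')).obj ((D.map v).obj Y) :=
  (D.obj_map_eq (costructuredArrowRightwards_comp_proj σ b') Y).trans (D.obj_map_eq rfl Y).symm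

theorem leftTranspose_hComp_commaSquareOver {v : A' ⥤ A} {u' : A' ⥤ B'} {u : A ⥤ B}
    {w : B' ⥤ B} (σ : TwoSquare v u' u w) (b' : B') {S : D.obj A ⥤ D.obj B}
    (adj : D.map u ⊣ S) (Y : D.obj A) (Z : D.obj Pt.{w})
    (φ : Z ⟶ (D.map (point (w.obj b'))).obj (S.obj Y)) :
    (TwoSquare.hComp (D.mapSquare σ) (D.mapSquare (commaSquareOver u' b'))).leftTranspose adj Y Z
        (φ ≫ eqToHom (D.obj_map_eq (point_comp b' w) _).symm) =
      eqToHom (D.obj_map_eq (comp_toPt _) Z).symm ≫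
        (D.map (σ.costructuredArrowRightwards b')).map
          ((D.mapSquare (commaSquareOver u (w.obj b'))).leftTranspose adj Y Z φ) ≫
        eqToHom (D.costructuredArrowRightwards_obj_eq σ b' Y) := by
  simp only [TwoSquare.leftTranspose, TwoSquare.natTrans, TwoSquare.hComp_app]
  erw [mapSquare_app, mapSquare_app, mapSquare_app]
  simp only [Functor.map_comp, eqToHom_map, map_map₂_app, map₂_app_obj, Functor.comp_map,
    Functor.comp_obj, Category.assoc, eqToHom_trans_assoc, eqToHom_trans,
    D.map_map_map (comp_toPt _), D.map_map_map (costructuredArrowRightwards_comp_proj σ b'),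
    D.map_map_map (rfl : CostructuredArrow.proj u' b' ⋙ v = _)]
  -- Both 2-cells have component `w(g') ∘ α_{a'}` at `(a', g')`: this is how the functor `A'/b' ⥤
  -- A/w(b')` acts on objects.
  have h := D.map₂_app_congr
    (f := σ.costructuredArrowRightwards b' ⋙ CostructuredArrow.proj u (w.obj b') ⋙ u)
    (f' := CostructuredArrow.proj u' b' ⋙ v ⋙ u)
    (g := σ.costructuredArrowRightwards b' ⋙ toPt _ ⋙ point (w.obj b'))
    (g' := (toPt _ ⋙ point b') ⋙ w) rfl (congrArg (toPt _ ⋙ ·) (point_comp b' w)).symm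
    (Functor.whiskerLeft (σ.costructuredArrowRightwards b')
      (commaSquareOver u (w.obj b')).natTrans)
    (Functor.whiskerLeft (CostructuredArrow.proj u' b') σ.natTrans ≫
      Functor.whiskerRight (commaSquareOver u' b').natTrans w)
    (fun a => by simp [commaSquareOver, TwoSquare.natTrans, TwoSquare.mk,
      TwoSquare.costructuredArrowRightwards]
                 exact (Category.id_comp _).symm) (S.obj Y)
  have h' := D.map₂_app_comp (Functor.whiskerLeft (CostructuredArrow.proj u' b') σ.natTrans)
    (Functor.whiskerRight (commaSquareOver u' b').natTrans w) rfl (S.obj Y)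
  simp only [eqToHom_refl, Category.id_comp] at h'
  rw [h, ← h']
  simp

theorem cohomologicalBaseChange_iff [D.IsComplete] (hD : D.IsConservative)
    {v : A' ⥤ A} {u' : A' ⥤ B'} {u : A ⥤ B} {w : B' ⥤ B} (σ : TwoSquare v u' u w) :
    D.CohomologicalBaseChange σ ↔ ∀ b', D.IsHomBijective (σ.costructuredArrowRightwards b')
      (CostructuredArrow.proj u (w.obj b')) := by
  -- Fibre at `b'` of the base change morphism. Completeness is used twice: for `u'` at `b'` to
  -- evaluate `u'_*`, and for `u` at `w(b')` to evaluate `u_*`.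
  have key (b' : B') (Y : D.obj A) : IsIso ((D.map (point b')).map
      ((mateEquiv (D.directImageAdjunction u) (D.directImageAdjunction u')
        (D.mapSquare σ)).natTrans.app Y)) ↔
      ∀ Z, Function.Bijective fun φ : (D.map (toPt _)).obj Z ⟶
        (D.map (CostructuredArrow.proj u (w.obj b'))).obj Y =>
          (D.map (σ.costructuredArrowRightwards b')).map φ := by
    rw [TwoSquare.isIso_map_mateEquiv_app_iff _ (D.mapSquare (commaSquareOver u' b'))
      (hτ := (TwoSquare.isLeftBeckChevalley_iff _ _).1
        (IsComplete.cohomologicalBaseChange u' b'))]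
    refine forall_congr' fun Z => ?_
    have h := (TwoSquare.isLeftBeckChevalley_iff _ (D.directImageAdjunction u)).1
        (IsComplete.cohomologicalBaseChange u (w.obj b')) Y Z
    rw [← h.of_comp_iff, ← bijective_eqToHom_conj_iff (D.obj_map_eq (comp_toPt _) Z).symm
      (D.costructuredArrowRightwards_obj_eq σ b' Y)]
    have e := ((Iso.refl Z).homCongr (eqToIso
      (D.obj_map_eq (point_comp b' w) ((D.directImage u).obj Y)).symm)).bijective
    rw [← Function.Bijective.of_comp_iff _ e]
    refine iff_of_eq (congrArg _ (funext fun φ => ?_))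
    have := D.leftTranspose_hComp_commaSquareOver σ b' (D.directImageAdjunction u) Y Z φ
    simpa [Iso.homCongr] using! this
  have h : D.CohomologicalBaseChange σ ↔ ∀ Y, IsIso ((mateEquiv (D.directImageAdjunction u)
      (D.directImageAdjunction u') (D.mapSquare σ)).natTrans.app Y) := by
    rw [CohomologicalBaseChange, TwoSquare.isLeftBeckChevalley_iff _ (D.directImageAdjunction u)]
    exact forall_congr' fun Y => (TwoSquare.isIso_mateEquiv_app_iff _ _ _ Y).symm
  rw [h]
  constructor
  · intro h b' Z Y
    have := h Y
    exact (key b' Y).1 inferInstance Z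
  · intro h Y
    exact hD _ _ fun b' => (key b' Y).2 fun Z => h b' Z Y

/-! ### Base change for the squares of `c\B` -/

/-- The adjunction `f^* ⊣ g^*` induced by an adjunction `f ⊣ g` of functors. -/
def mapAdjunction {f : A ⥤ B} {g : B ⥤ A} (adj : f ⊣ g) : D.map f ⊣ D.map g where
  unit := eqToHom (D.map_id B).symm ≫ D.map₂ adj.counit ≫ eqToHom (D.map_comp g f)
  counit := eqToHom (D.map_comp f g).symm ≫ D.map₂ adj.unit ≫ eqToHom (D.map_id A)
  left_triangle_components X := by
    have h := D.map₂_app_comp (Functor.whiskerRight adj.unit f)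
      (Functor.whiskerLeft f adj.counit) rfl X
    have h' : Functor.whiskerRight adj.unit f ≫ eqToHom rfl ≫ Functor.whiskerLeft f adj.counit =
        𝟙 f := by
      ext a
      simp
    simp only [Functor.id_obj, Functor.comp_obj, NatTrans.comp_app, eqToHom_app, Functor.map_comp,
      eqToHom_map, map_map₂_app, Category.assoc, eqToHom_trans, eqToHom_trans_assoc, map₂_app_obj,
      eqToHom_refl, Category.comp_id, Category.id_comp]
    simp only [eqToHom_refl, Category.id_comp] at h h'
    exact h.trans ((congrArg (fun t : f ⟶ f => (D.map₂ t).app X)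
      h').trans (by rw [D.map₂_id]; rfl))
  right_triangle_components X := by
    have h := D.map₂_app_comp (Functor.whiskerLeft g adj.unit)
      (Functor.whiskerRight adj.counit g) rfl X
    have h' : Functor.whiskerLeft g adj.unit ≫ eqToHom rfl ≫ Functor.whiskerRight adj.counit g =
        𝟙 g := by
      ext a
      simp
    simp only [Functor.id_obj, Functor.comp_obj, NatTrans.comp_app, eqToHom_app, Functor.map_comp,
      eqToHom_map, map_map₂_app, Category.assoc, eqToHom_trans, eqToHom_trans_assoc, map₂_app_obj,
      eqToHom_refl, Category.comp_id, Category.id_comp]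
    simp only [eqToHom_refl, Category.id_comp] at h h'
    exact h.trans ((congrArg (fun t : g ⟶ g => (D.map₂ t).app X)
      h').trans (by rw [D.map₂_id]; rfl))

/-- Since `D` reverses 2-cells, the unit of `f^* ⊣ g^*` comes from the counit of `f ⊣ g`; a left
adjoint with invertible unit is fully faithful. -/
theorem map_full_and_faithful_of_adjunction {f : A ⥤ B} {g : B ⥤ A} (adj : f ⊣ g)
    [IsIso adj.counit] : (D.map f).Full ∧ (D.map f).Faithful := by
  have : IsIso (D.map₂ adj.counit) :=
    ⟨D.map₂ (inv adj.counit), by simp [← D.map₂_comp, D.map₂_id], by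
      simp [← D.map₂_comp, D.map₂_id]⟩
  have : IsIso (D.mapAdjunction adj).unit := by
    dsimp [mapAdjunction]
    infer_instance
  let h := (D.mapAdjunction adj).fullyFaithfulLOfIsIsoUnit
  exact ⟨h.full, h.faithful⟩

/-- The functor `C(c, g b) ⥤ (c\B)/b` sending `k : c ⟶ g b` to the identity of `b`, as an arrow
with source the object `k` of `c\B`. -/
def underOverSection (g : B ⥤ C) (c : C) (b : B) :
    CostructuredArrow (point c) (g.obj b) ⥤ CostructuredArrow (StructuredArrow.proj c g) b where
  obj X := CostructuredArrow.mk (Y := StructuredArrow.mk (Y := b) X.hom) (𝟙 b)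
  map {X Y} k := CostructuredArrow.homMk (StructuredArrow.homMk (𝟙 b) (by
    have := CostructuredArrow.w k
    simp only [Functor.const_obj_map] at this
    exact (congrArg (X.hom ≫ ·) (g.map_id b)).trans ((Category.comp_id _).trans
      (this.symm.trans (Category.id_comp _))))) (Category.id_comp _)
  map_id X := by ext; rfl
  map_comp X Y := by ext; exact (Category.id_comp _).symm

theorem hom_eq_of_costructuredArrow_point {c : C} {d : C} {X Y : CostructuredArrow (point c) d}
    (k l : X ⟶ Y) : k = l := by
  ext
  exact Subsingleton.elim _ _

theorem hom_eq_of_hom_to_underOverSection (g : B ⥤ C) (c : C) (b : B) {X} {Y}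
    (k l : X ⟶ (underOverSection g c b).obj Y) : k = l := by
  have hk := CostructuredArrow.w k
  have hl := CostructuredArrow.w l
  ext
  exact (Category.comp_id _).symm.trans ((hk.trans hl.symm).trans (Category.comp_id _))

/-- The functor `(c\B)/b ⥤ C(c, g b)` given by composition is left adjoint to `underOverSection`. -/
def underOverAdjunction (g : B ⥤ C) (c : C) (b : B) :
    (commaSquareUnder g c).costructuredArrowRightwards b ⊣ underOverSection g c b where
  unit :=
    { app X := CostructuredArrow.homMk (StructuredArrow.homMk X.hom rfl) (Category.comp_id _)
      naturality _ _ _ := hom_eq_of_hom_to_underOverSection g c b _ _ }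
  counit :=
    { app X := CostructuredArrow.homMk (𝟙 _) (by
        refine (Category.id_comp _).trans ?_
        exact ((congrArg (X.hom ≫ ·) (g.map_id b)).trans (Category.comp_id _)).symm) 
      naturality _ _ _ := hom_eq_of_costructuredArrow_point _ _  }
  left_triangle_components X := hom_eq_of_costructuredArrow_point _ _
  right_triangle_components X := hom_eq_of_hom_to_underOverSection g c b _ _

/-- The functors to be tested are `(c\B)/b ⥤ C(c, g b)`. Each is left adjoint to a fully faithful
section, so its inverse image is fully faithful. -/
theorem cohomologicalBaseChange_commaSquareUnder [D.IsComplete] (hD : D.IsConservative)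
    (g : B ⥤ C) (c : C) : D.CohomologicalBaseChange (commaSquareUnder g c) := by
  rw [D.cohomologicalBaseChange_iff hD]
  intro b Z Y
  have : IsIso (underOverAdjunction g c b).counit := by
    rw [NatTrans.isIso_iff_isIso_app]
    -- The target is discrete: its projection to `e` reflects isomorphisms, and every morphism of
    -- `e` is invertible.
    exact fun X => isIso_of_reflects_iso _ (CostructuredArrow.proj _ _)
  obtain ⟨_, _⟩ := D.map_full_and_faithful_of_adjunction (underOverAdjunction g c b)
  exact ⟨(D.map _).map_injective, (D.map _).map_surjective⟩

/-! ### Hom-bijectivity and colocal equivalences -/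

theorem structuredArrow_pre_comp_proj (f : A ⥤ B) (g : B ⥤ C) (c : C) :
    StructuredArrow.pre c f g ⋙ StructuredArrow.proj c g =
      StructuredArrow.proj c (f ⋙ g) ⋙ f :=
  rfl

theorem structuredArrow_pre_obj_eq (f : A ⥤ B) (g : B ⥤ C) (c : C) (W : D.obj B) :
    (D.map (StructuredArrow.pre c f g)).obj ((D.map (StructuredArrow.proj c g)).obj W) =
      (D.map (StructuredArrow.proj c (f ⋙ g))).obj ((D.map f).obj W) :=
  (D.obj_map_eq (structuredArrow_pre_comp_proj f g c) W).trans (D.obj_map_eq rfl W).symm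

/-- The comma square of `f ⋙ g` at `c` is that of `g` restricted along `c\A ⥤ c\B`. The morphisms
`a` and `b` are left free so as to serve both transposes: `b` becomes the counit of `c^* ⊣ c_*`, or
`a` the unit of `g_! ⊣ g^*`. -/
theorem map_structuredArrow_pre_map (f : A ⥤ B) (g : B ⥤ C) (c : C) {W : D.obj B} {N : D.obj C}
    {X : D.obj Pt.{w}} (a : W ⟶ (D.map g).obj N) (b : (D.map (point c)).obj N ⟶ X) :
    (D.map (StructuredArrow.pre c f g)).map ((D.map (StructuredArrow.proj c g)).map a ≫
        (D.mapSquare (commaSquareUnder g c)).natTrans.app N ≫ (D.map (toPt _)).map b) =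
      eqToHom (D.structuredArrow_pre_obj_eq f g c W) ≫
        ((D.map (StructuredArrow.proj c (f ⋙ g))).map
            ((D.map f).map a ≫ eqToHom (D.obj_map_eq rfl N)) ≫
          (D.mapSquare (commaSquareUnder (f ⋙ g) c)).natTrans.app N ≫ (D.map (toPt _)).map b) ≫
        eqToHom (D.obj_map_eq (comp_toPt _) X).symm := by
  have h := D.map₂_app_congr
    (f := StructuredArrow.pre c f g ⋙ toPt _ ⋙ point c)
    (f' := toPt (StructuredArrow c (f ⋙ g)) ⋙ point c)
    (g := StructuredArrow.pre c f g ⋙ StructuredArrow.proj c g ⋙ g)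
    (g' := StructuredArrow.proj c (f ⋙ g) ⋙ f ⋙ g)
    (congrArg (· ⋙ point c) (comp_toPt (StructuredArrow.pre c f g))) rfl
    (Functor.whiskerLeft (StructuredArrow.pre c f g) (commaSquareUnder g c).natTrans)
    (commaSquareUnder (f ⋙ g) c).natTrans
    (fun a => by simp [commaSquareUnder, TwoSquare.natTrans, TwoSquare.mk]
                 exact (Category.comp_id _).symm) N
  rw [mapSquare_app, mapSquare_app]
  simp only [Functor.map_comp, eqToHom_map, map_map₂_app, Functor.comp_obj, Category.assoc,
    eqToHom_trans_assoc, eqToHom_trans, D.map_map_map (comp_toPt _),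
    D.map_map_map (structuredArrow_pre_comp_proj f g c),
    D.map_map_map (rfl : StructuredArrow.proj c (f ⋙ g) ⋙ f = _)]
  rw [h]
  simp

theorem IsHomBijective.isColocalDEquivalence [D.IsComplete] (hD : D.IsConservative)
    {f : A ⥤ B} {g : B ⥤ C} (h : D.IsHomBijective f g) : D.IsColocalDEquivalence f g := by
  intro c Z X
  have hB := (TwoSquare.isLeftBeckChevalley_iff _ (D.directImageAdjunction (point c))).1
    (D.cohomologicalBaseChange_commaSquareUnder hD g c) X ((D.map (toPt B)).obj Z)
  have hA := (TwoSquare.isLeftBeckChevalley_iff _ (D.directImageAdjunction (point c))).1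
    (D.cohomologicalBaseChange_commaSquareUnder hD (f ⋙ g) c) X
      ((D.map f).obj ((D.map (toPt B)).obj Z))
  -- The choice `Y = c_* X` lets `hB` and `hA` identify source and target with Hom sets over `c\B`
  -- and `c\A`.
  have hf := h Z ((D.directImage (point c)).obj X)
  rw [← bijective_eqToHom_comp_iff (D.obj_map_eq (comp_toPt (StructuredArrow.proj c g)) Z).symm] at hB
  rw [← bijective_comp_eqToHom_iff (D.obj_map_eq rfl ((D.directImage (point c)).obj X))] at hf
  rw [← hB.of_comp_iff]
  have hAf := hA.comp hf
  rw [← bijective_eqToHom_conj_iff (D.structuredArrow_pre_obj_eq f g c ((D.map (toPt B)).obj Z))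
      (D.obj_map_eq (comp_toPt (StructuredArrow.pre c f g)) X).symm,
    ← bijective_eqToHom_comp_iff (congrArg (D.map (StructuredArrow.pre c f g)).obj
      (D.obj_map_eq (comp_toPt (StructuredArrow.proj c g)) Z).symm)] at hAf
  convert hAf using 1
  funext φ
  have := D.map_structuredArrow_pre_map f g c φ
    ((D.directImageAdjunction (point c)).counit.app X)
  simp only [Function.comp_apply, Functor.map_comp _ (eqToHom _), eqToHom_map]
  exact congrArg _ this

theorem isHomBijective_of_isColocalDEquivalence [D.IsCocomplete] (hD : D.IsConservative)
    {f : A ⥤ B} {g : B ⥤ C} (h : D.IsColocalDEquivalence f g) : D.IsHomBijective f g := by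
  intro Z Y
  have : (D.map g).IsRightAdjoint := HasHomologicalDirectImages.isRightAdjoint g
  have : (D.map (f ⋙ g)).IsRightAdjoint := HasHomologicalDirectImages.isRightAdjoint (f ⋙ g)
  let adj := Adjunction.ofIsRightAdjoint (D.map g)
  let adj' := Adjunction.ofIsRightAdjoint (D.map (f ⋙ g))
  let W := (D.map (toPt B)).obj Z
  let N := (D.map g).leftAdjoint.obj W
  let N' := (D.map (f ⋙ g)).leftAdjoint.obj ((D.map f).obj W)
  -- The canonical morphism `(f ⋙ g)_! f^* W ⟶ g_! W`, dual to `directImageComparison` but evaluated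
  -- only at the constant object `W = q^* Z`.
  let θ : N' ⟶ N :=
    (adj'.homEquiv _ _).symm ((D.map f).map (adj.unit.app W) ≫ eqToHom (D.obj_map_eq rfl N))
  have hθ : (D.map f).map (adj.unit.app W) ≫ eqToHom (D.obj_map_eq rfl N) =
      adj'.unit.app ((D.map f).obj W) ≫ (D.map (f ⋙ g)).map θ :=
    ((adj'.homEquiv _ _).apply_symm_apply _).symm.trans (adj'.homEquiv_unit _ _ _)
  have : IsIso θ := by
    refine hD _ θ fun c => ?_
    rw [isIso_iff_coyoneda_map_bijective]
    intro X
    -- Maps from `c^* g_! W` and `c^* (f ⋙ g)_! f^* W` to `X` become maps between constant objects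
    -- on `c\B` and `c\A`; precomposition with `c^* θ` becomes inverse image along `c\A ⥤ c\B`,
    -- bijective by hypothesis.
    have hB := (IsCocomplete.homologicalBaseChange (D := D) g c).bijective adj W X
    have hA := (IsCocomplete.homologicalBaseChange (D := D) (f ⋙ g) c).bijective adj'
      ((D.map f).obj W) X
    rw [← bijective_eqToHom_comp_iff (D.obj_map_eq (comp_toPt (StructuredArrow.proj c g)) Z).symm]
      at hB
    rw [← hA.of_comp_iff',
      ← bijective_eqToHom_conj_iff (D.structuredArrow_pre_obj_eq f g c W)
      (D.obj_map_eq (comp_toPt (StructuredArrow.pre c f g)) X).symm,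
      ← bijective_eqToHom_comp_iff (congrArg (D.map (StructuredArrow.pre c f g)).obj
      (D.obj_map_eq (comp_toPt (StructuredArrow.proj c g)) Z).symm)]
    convert (h c Z X).comp hB using 1
    funext ψ
    have h₁ := D.map_structuredArrow_pre_map f g c (adj.unit.app W) ψ
    have h₂ := (D.mapSquare (commaSquareUnder (f ⋙ g) c)).natTrans.naturality θ
    simp only [Functor.comp_map] at h₂
    have h₃ : (D.map (StructuredArrow.proj c (f ⋙ g))).map
          (adj'.unit.app ((D.map f).obj W) ≫ (D.map (f ⋙ g)).map θ) ≫
        (D.mapSquare (commaSquareUnder (f ⋙ g) c)).natTrans.app N ≫ (D.map (toPt _)).map ψ =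
      (D.mapSquare (commaSquareUnder (f ⋙ g) c)).rightTranspose adj' _ X
        ((D.map (point c)).map θ ≫ ψ) := by
      rw [TwoSquare.rightTranspose, Functor.map_comp, Functor.map_comp, Category.assoc,
        reassoc_of% h₂]
    rw [hθ] at h₁
    simp only [Function.comp_apply, Functor.map_comp _ (eqToHom _), eqToHom_map]
    exact congrArg _ (h₁.trans (congrArg (fun t => eqToHom _ ≫ t ≫ eqToHom _) h₃)).symm
  -- Under the adjunctions for `g_!` and `(f ⋙ g)_!`, the action of `f^*` on morphisms `W ⟶ g^* Y`
  -- is precomposition with `θ`.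
  have hψ := ((adj'.homEquiv _ Y).bijective.comp
    ((isIso_iff_coyoneda_map_bijective θ).1 inferInstance Y))
  rw [← bijective_comp_eqToHom_iff (D.obj_map_eq rfl Y).symm] at hψ
  rw [← (adj.homEquiv W Y).bijective.of_comp_iff]
  convert hψ using 1
  funext ψ
  simp only [Function.comp_apply, Adjunction.homEquiv_unit, Functor.map_comp, ← reassoc_of% hθ,
    Category.assoc, D.map_map_map (rfl : f ⋙ g = f ⋙ g)]

end Prederivator

theorem mainTheorem1 :
    (∀ (D : Prederivator.{w, v, u}) [D.IsComplete], D.IsConservative → D.ColocalCriterion →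
      ∀ {A' A B' B : Type w} [SmallCategory.{w} A'] [SmallCategory.{w} A]
        [SmallCategory.{w} B'] [SmallCategory.{w} B]
        {v : A' ⥤ A} {u' : A' ⥤ B'} {u : A ⥤ B} {w : B' ⥤ B} (σ : TwoSquare v u' u w),
        D.CohomologicalBaseChange σ ↔ D.IsWeaklyExact σ) ∧
    (∀ (D : Prederivator.{w, v, u}), D.IsDerivator →
      D.IsConservative ∧ ∃ _ : D.IsComplete, D.ColocalCriterion) := by
  refine ⟨fun D _ hD hC => ?_, fun D h => ⟨h.isConservative, h.isComplete, ?_⟩⟩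
  · intro A' A B' B _ _ _ _ v u' u w σ
    rw [D.cohomologicalBaseChange_iff hD]
    exact forall_congr' fun b' => ⟨fun h => h.isColocalDEquivalence D hD,
      fun h => (D.isIso_directImageComparison_iff _ _).1 (hC _ _ h)⟩
  · intro A B C _ _ _ f g hfg
    have := h.isComplete
    have := h.isCocomplete
    exact (D.isIso_directImageComparison_iff f g).2
      (D.isHomBijective_of_isColocalDEquivalence h.isConservative hfg)
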